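/- Consider a Majorana neutrino mass model $m_\nu = f\,Y^T M Y$, where $f\in\mathbb{C}$, $M$ is a symmetric complex $n\times n$ matrix of rank $r_M$, $m_\nu$ is a complex $3\times 3$ matrix of rank $r_m\in\{2,3\}$, and $Y$ is a complex $n\times 3$ (Yukawa) matrix on which no constraint other than this equation is imposed; $f$, $M$, $m_\nu$ are fixed and such that the equation has a solution $Y$. There are Takagi decompositions $U^T m_\nu U=\mathrm{diag}(m_1,m_2,m_3)$ and $V^*MV^\dagger=\mathrm{diag}(M_1,\dots,M_n)$ with $U,V$ unitary, $m_i,M_i\ge 0$, $M_i>0$ exactly for $i\le r_M$, and, if $r_m=2$, $m_1=0$ (normal hierarchy, NH) or $m_3=0$ (inverted hierarchy, IH), as one prefers. Put $D_{r_M}=\mathrm{diag}(M_1,\dots,M_{r_M})$, and let $D_{\sqrt m}$ be the $r_m\times 3$ matrix $\mathrm{diag}(\sqrt{m_1},\sqrt{m_2},\sqrt{m_3})$ if $r_m=3$, $\begin{pmatrix}0&\sqrt{m_2}&0\\0&0&\sqrt{m_3}\end{pmatrix}$ if $r_m=2$ (NH), and $\begin{pmatrix}0&\sqrt{m_2}&0\\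 \sqrt{m_1}&0&0\end{pmatrix}$ if $r_m=2$ (IH). The extended Casas-Ibarra parametrization is $$Y=\frac{1}{\sqrt f}\,V^\dagger\begin{pmatrix}\sqrt{D_{r_M}}^{\,-1}R\,D_{\sqrt m}\,U^\dagger\\ X\end{pmatrix},$$ where $R$ is any complex $r_M\times r_m$ matrix with $R^TR=\mathbb{I}_{r_m}$ and $X$ is any complex $(n-r_M)\times 3$ matrix. All these $Y$ solve $m_\nu=f\,Y^TMY$, and they are all the solutions if $r_m=3$ or $r_M\le 3$. A set of matrices is said to have $d$ real free parameters if it is a nonempty embedded smooth submanifold of real dimension $d$. For every such model and every choice of the Takagi decompositions, the set of matrices $Y$ given by the extended Casas-Ibarra parametrization has exactly $$\#_Y=6n-2r_M(3-r_m)-r_m(r_m+1)$$ real free parameters, and for no other number does this hold. Every solution $Y$ satisfies $r_m\le\min(\mathrm{rank}\,Y,r_M)$, $\mathrm{rank}\,Y\le\min(n,3)$ and $r_M\le n$. The minimum of $\#_Y$ over all models is $2$, and $\#_Y=2$ if and only if $n=r_M=r_m=2$. In that case the set of all solutions $Y$ of $m_\nu=f\,Y^TMY$ has two real free parameters: minimal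 Majorana neutrino mass models have two real degrees of freedom in $Y$. -/

import Mathlib

open scoped Matrix ContDiff

attribute [local instance] Matrix.normedAddCommGroup Matrix.normedSpace

/-- The elements of `S` have exactly `d` real free parameters: `S` is nonempty and every point of
`S` has a relatively open neighbourhood in `S` that is the homeomorphic image of an open subset of
`ℝ ^ d` under a smooth map whose derivative is everywhere injective.  In other words, `S` is a
nonempty embedded smooth submanifold of `E`, of real dimension `d` at each of its points. -/
def HasFreeRealParameters {E : Type*} [NormedAddCommGroup E] [NormedSpace ℝ E]
    (S : Set E) (d : ℕ) : Prop :=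
  S.Nonempty ∧ ∀ y : S, ∃ φ : OpenPartialHomeomorph (EuclideanSpace ℝ (Fin d)) S,
    y ∈ φ.target ∧
    ContDiffOn ℝ ∞ (fun t => (φ t : E)) φ.source ∧
    ∀ t ∈ φ.source, Function.Injective (fderiv ℝ (fun t => (φ t : E)) t)

/-- A Majorana neutrino mass model: a complex number `f`, a symmetric complex `n × n` matrix `M`
and the `3 × 3` neutrino mass matrix `mν`, which is of the form `f Yᵀ M Y` for some (otherwise
unconstrained) complex `n × 3` Yukawa matrix `Y`, and has rank `2` or `3`
(at most one neutrino is massless). -/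
structure MajoranaModel (n : ℕ) where
  f : ℂ
  M : Matrix (Fin n) (Fin n) ℂ
  mν : Matrix (Fin 3) (Fin 3) ℂ
  symm : M.IsSymm
  exists_yukawa : ∃ Y : Matrix (Fin n) (Fin 3) ℂ, mν = f • (Yᵀ * M * Y)
  rank_mν : mν.rank = 2 ∨ mν.rank = 3

/-- The neutrino mass hierarchy, normal or inverted. -/
inductive MassHierarchy where
  | NH
  | IH

namespace MassHierarchy

/-- The index of the neutrino that is massless when `mν` has rank `2`. -/
def lightest : MassHierarchy → Fin 3
  | NH => 0
  | IH => 2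

/-- The permutation matrix `P`. -/
def P : MassHierarchy → Matrix (Fin 3) (Fin 3) ℂ
  | NH => 1
  | IH => !![0, 0, 1; 0, 1, 0; 1, 0, 0]

/-- The masses, relabelled by the permutation `P`, so that the lightest one comes first. -/
def relabel (μ : Fin 3 → ℝ) : MassHierarchy → Fin 3 → ℝ
  | NH => μ
  | IH => fun i => μ i.rev

end MassHierarchy

/-- The `r × 3` matrix `D_{√m}`, for `r = 3` and `r = 2`. It satisfies
`D_{√m}ᵀ D_{√m} = diag(m₁, m₂, m₃)`; for `r = 2` the zero mass is `m₁` in the normal hierarchy and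
`m₃` in the inverted one, and the masses are relabelled together with the columns. The value for
other `r` is never used. -/
noncomputable def sqrtMass (h : MassHierarchy) (μ : Fin 3 → ℝ) :
    (r : ℕ) → Matrix (Fin r) (Fin 3) ℂ
  | 3 => Matrix.diagonal fun i => ((√(μ i) : ℝ) : ℂ)
  | 2 => !![0, ((√(h.relabel μ 1) : ℝ) : ℂ), 0; 0, 0, ((√(h.relabel μ 2) : ℝ) : ℂ)] * h.P
  | _ => 0

namespace MajoranaModel

variable {n : ℕ}

/-- The rank of `M`. -/
noncomputable def rM (𝓜 : MajoranaModel n) : ℕ := 𝓜.M.rank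

/-- The rank of the neutrino mass matrix. -/
noncomputable def rm (𝓜 : MajoranaModel n) : ℕ := 𝓜.mν.rank

theorem rM_le (𝓜 : MajoranaModel n) : 𝓜.rM ≤ n := by
  simpa [rM] using Matrix.rank_le_card_height 𝓜.M

/-- All Yukawa matrices that reproduce the neutrino mass matrix: `mν = f Yᵀ M Y`. -/
def yukawas (𝓜 : MajoranaModel n) : Set (Matrix (Fin n) (Fin 3) ℂ) :=
  {Y | 𝓜.mν = 𝓜.f • (Yᵀ * 𝓜.M * Y)}

/-- Takagi decompositions `Uᵀ mν U = diag(m₁, m₂, m₃)` and `V^* M V† = diag(M₁, …, Mₙ)`, with `U`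
and `V` unitary, and with nonnegative entries on the right, arranged so that the nonzero `Mᵢ` are
the first `rM` ones and so that, if `mν` has rank `2`, the lightest neutrino of the hierarchy `h`
is the massless one. -/
structure Takagi (𝓜 : MajoranaModel n) (h : MassHierarchy) where
  U : Matrix (Fin 3) (Fin 3) ℂ
  V : Matrix (Fin n) (Fin n) ℂ
  lightMass : Fin 3 → ℝ
  heavyMass : Fin n → ℝ
  U_unitary : U ∈ Matrix.unitaryGroup (Fin 3) ℂ
  V_unitary : V ∈ Matrix.unitaryGroup (Fin n) ℂ
  lightMass_nonneg : ∀ i, 0 ≤ lightMass i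
  heavyMass_nonneg : ∀ i, 0 ≤ heavyMass i
  light_eq : Uᵀ * 𝓜.mν * U = Matrix.diagonal fun i => (lightMass i : ℂ)
  heavy_eq : V.map star * 𝓜.M * Vᴴ = Matrix.diagonal fun i => (heavyMass i : ℂ)
  lightest_eq : 𝓜.rm = 2 → lightMass h.lightest = 0
  heavyMass_pos : ∀ i, 0 < heavyMass i ↔ (i : ℕ) < 𝓜.rM

/-- The matrix whose first `rM` rows are those of `A` and whose last `n - rM` rows are those of
`X`. -/
noncomputable def stack (𝓜 : MajoranaModel n) (A : Matrix (Fin 𝓜.rM) (Fin 3) ℂ)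
    (X : Matrix (Fin (n - 𝓜.rM)) (Fin 3) ℂ) : Matrix (Fin n) (Fin 3) ℂ :=
  Matrix.reindex (finSumFinEquiv.trans (finCongr (Nat.add_sub_cancel' 𝓜.rM_le)))
    (Equiv.refl (Fin 3)) (Matrix.fromRows A X)

/-- The inverse of the `rM × rM` matrix `√D_{rM}`. -/
noncomputable def Takagi.sqrtHeavyInv {𝓜 : MajoranaModel n} {h : MassHierarchy}
    (T : 𝓜.Takagi h) : Matrix (Fin 𝓜.rM) (Fin 𝓜.rM) ℂ :=
  Matrix.diagonal fun i => ((√(T.heavyMass (Fin.castLE 𝓜.rM_le i)) : ℝ) : ℂ)⁻¹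

/-- The Yukawa matrix with parameters `R` and `X` in the extended Casas–Ibarra parametrization,
`Y = (1 / √f) V† (√D_{rM}⁻¹ R D_{√m} U† ; X)`. -/
noncomputable def Takagi.yukawa {𝓜 : MajoranaModel n} {h : MassHierarchy} (T : 𝓜.Takagi h)
    (R : Matrix (Fin 𝓜.rM) (Fin 𝓜.rm) ℂ) (X : Matrix (Fin (n - 𝓜.rM)) (Fin 3) ℂ) :
    Matrix (Fin n) (Fin 3) ℂ :=
  (𝓜.f ^ (1 / 2 : ℂ))⁻¹ •
    (T.Vᴴ * 𝓜.stack (T.sqrtHeavyInv * R * sqrtMass h T.lightMass 𝓜.rm * T.Uᴴ) X)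

/-- The Yukawa matrices given by the extended Casas–Ibarra parametrization, where `R` ranges over
all complex `rM × rm` matrices with `Rᵀ R = 1` and `X` over all complex `(n - rM) × 3` matrices. -/
def Takagi.casasIbarra {𝓜 : MajoranaModel n} {h : MassHierarchy} (T : 𝓜.Takagi h) :
    Set (Matrix (Fin n) (Fin 3) ℂ) :=
  {Y | ∃ (R : Matrix (Fin 𝓜.rM) (Fin 𝓜.rm) ℂ) (X : Matrix (Fin (n - 𝓜.rM)) (Fin 3) ℂ),
    Rᵀ * R = 1 ∧ Y = T.yukawa R X}

end MajoranaModel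

/-! After rotating by the unitary matrices `U`, `V` and rescaling by the square roots of `f` and of
the heavy masses, the mass equation becomes `Bᵀ * B = Dᵀ * D`, where `D` is `sqrtMass` and `B` comes
from the first `rM` rows of the rotated `Y`. The remaining rows meet only zero heavy masses and stay
free. Every `B = R * D` with `Rᵀ * R = 1` is a solution; the converse is the rank argument in
`Matrix.mem_of_transpose_mul_self_eq`.

For the count, `(R, X) ↦ Y` is linear and injective over `ℝ`, so the set of `Y` is a linear copy of
the level set `Rᵀ * R = 1`. This level set is regular (`surjective_fderiv_gramDefect`), so its
dimension is the number of real coordinates, `2 rM rm + 6 (n - rM)`, minus the number of real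
equations, `rm (rm + 1)`. Uniqueness of `d` is invariance of dimension for smooth charts. The
minimum follows by arithmetic from `rm ≤ rM ≤ n` and `rm ∈ {2, 3}`. -/

/-! ### Embedded submanifolds: invariance of dimension, linear images, regular level sets. -/

open Filter Topology in
theorem HasFreeRealParameters.dim_le {E : Type*} [NormedAddCommGroup E] [NormedSpace ℝ E]
    [FiniteDimensional ℝ E] {S : Set E} {d d' : ℕ}
    (h : HasFreeRealParameters S d) (h' : HasFreeRealParameters S d') : d' ≤ d := by
  obtain ⟨⟨y, hy⟩, h⟩ := h
  obtain ⟨φ, hyφ, hφ, hφi⟩ := h ⟨y, hy⟩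
  obtain ⟨ψ, hyψ, hψ, hψi⟩ := h'.2 ⟨y, hy⟩
  set F : EuclideanSpace ℝ (Fin d) → E := fun t => φ t with hF
  set G : EuclideanSpace ℝ (Fin d') → E := fun t => ψ t with hG
  set t₀ := φ.symm ⟨y, hy⟩ with ht₀_def
  set s₀ := ψ.symm ⟨y, hy⟩ with hs₀_def
  have ht₀ : t₀ ∈ φ.source := φ.map_target hyφ
  have hs₀ : s₀ ∈ ψ.source := ψ.map_target hyψ
  have hψs₀ : ψ s₀ = ⟨y, hy⟩ := ψ.right_inv hyψ
  have sF : HasStrictFDerivAt F (fderiv ℝ F t₀) t₀ :=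
    (hφ.contDiffAt (φ.open_source.mem_nhds ht₀)).hasStrictFDerivAt (by simp)
  have dG : HasFDerivAt G (fderiv ℝ G s₀) s₀ :=
    ((hψ.contDiffAt (ψ.open_source.mem_nhds hs₀)).differentiableAt (by simp)).hasFDerivAt
  -- A left inverse `P` of the derivative makes `P ∘ F` a map with identity derivative at `t₀`,
  -- hence locally invertible there.
  obtain ⟨P, hP⟩ := LinearMap.exists_leftInverse_of_injective (fderiv ℝ F t₀).toLinearMap
    (LinearMap.ker_eq_bot.2 (hφi t₀ ht₀))
  let P' : E →L[ℝ] EuclideanSpace ℝ (Fin d) := LinearMap.toContinuousLinearMap P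
  have sPF : HasStrictFDerivAt (P' ∘ F) ((ContinuousLinearEquiv.refl ℝ _ :
      EuclideanSpace ℝ (Fin d) ≃L[ℝ] EuclideanSpace ℝ (Fin d)) :
      EuclideanSpace ℝ (Fin d) →L[ℝ] EuclideanSpace ℝ (Fin d)) t₀ := by
    have h1 := P'.hasStrictFDerivAt.comp t₀ sF
    have h2 : P'.comp (fderiv ℝ F t₀) = ((ContinuousLinearEquiv.refl ℝ _ :
        EuclideanSpace ℝ (Fin d) ≃L[ℝ] EuclideanSpace ℝ (Fin d)) :
        EuclideanSpace ℝ (Fin d) →L[ℝ] EuclideanSpace ℝ (Fin d)) :=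
      ContinuousLinearMap.ext fun x => LinearMap.congr_fun hP x
    rw [h2] at h1
    exact h1
  let θ : EuclideanSpace ℝ (Fin d') → EuclideanSpace ℝ (Fin d) := fun s => φ.symm (ψ s)
  have hθs₀ : θ s₀ = t₀ := by simp only [θ, hψs₀, ht₀_def]
  have θc : ContinuousAt θ s₀ := by
    refine ContinuousAt.comp ?_ (ψ.continuousAt hs₀)
    rw [hψs₀]
    exact φ.continuousAt_symm hyφ
  have hev : ∀ᶠ s in 𝓝 s₀, F (θ s) = G s := by
    have : ∀ᶠ s in 𝓝 s₀, ψ s ∈ φ.target := by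
      refine (ψ.continuousAt hs₀).eventually_mem ?_
      rw [hψs₀]
      exact φ.open_target.mem_nhds hyφ
    filter_upwards [this] with s hs
    simp only [hF, hG, θ, φ.right_inv hs]
  have hPG : (P' ∘ G) s₀ = (P' ∘ F) t₀ := by
    simp only [Function.comp, hF, hG, hψs₀, ht₀_def, φ.right_inv hyφ]
  -- The inverse chart is only known to be continuous; this formula makes the transition map `θ`
  -- differentiable at `s₀`.
  have hθ : θ =ᶠ[𝓝 s₀] sPF.localInverse (P' ∘ F) _ t₀ ∘ (P' ∘ G) := by
    have h1 := θc.tendsto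
    rw [hθs₀] at h1
    filter_upwards [h1.eventually sPF.eventually_left_inverse, hev] with s h2 h3
    simp only [Function.comp, ← h3]
    exact h2.symm
  have hinv := sPF.to_localInverse.hasFDerivAt
  rw [← hPG] at hinv
  have dθ := (hinv.comp s₀ (P'.hasFDerivAt.comp s₀ dG)).congr_of_eventuallyEq hθ
  have sF' := sF.hasFDerivAt
  rw [← hθs₀] at sF'
  -- From `F ∘ θ = G` near `s₀`, the injective derivative of `G` factors through that of `θ`, which
  -- is therefore injective, so `d' ≤ d`.
  have hcomp := ((sF'.comp s₀ dθ).congr_of_eventuallyEq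
    (hev.mono fun s hs => hs.symm)).unique dG
  have hi := hψi s₀ hs₀
  rw [← hcomp, ContinuousLinearMap.coe_comp] at hi
  have hle := LinearMap.finrank_le_finrank_of_injective
    (f := ContinuousLinearMap.toLinearMap _) hi.of_comp
  simpa using hle

theorem HasFreeRealParameters.unique {E : Type*} [NormedAddCommGroup E] [NormedSpace ℝ E]
    [FiniteDimensional ℝ E] {S : Set E} {d d' : ℕ}
    (h : HasFreeRealParameters S d) (h' : HasFreeRealParameters S d') : d = d' :=
  le_antisymm (h'.dim_le h) (h.dim_le h')

theorem HasFreeRealParameters.image {E E' : Type*} [NormedAddCommGroup E] [NormedSpace ℝ E]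
    [NormedAddCommGroup E'] [NormedSpace ℝ E'] [FiniteDimensional ℝ E]
    {S : Set E} {d : ℕ} (h : HasFreeRealParameters S d)
    (J : E →L[ℝ] E') (hJ : Function.Injective J) : HasFreeRealParameters (J '' S) d := by
  have hemb : Topology.IsEmbedding J :=
    (LinearMap.isClosedEmbedding_of_injective (f := J.toLinearMap)
      (LinearMap.ker_eq_bot.2 hJ)).isEmbedding
  let H : S ≃ₜ J '' S := hemb.homeomorphImage S
  have hH : ∀ s : S, ((H s : J '' S) : E') = J s := fun s => rfl
  refine ⟨h.1.image J, fun y => ?_⟩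
  obtain ⟨φ, hy, hφ, hi⟩ := h.2 (H.symm y)
  refine ⟨φ.transHomeomorph H, ?_, ?_, ?_⟩
  · simpa using hy
  · have : ContDiffOn ℝ ∞ (fun t => J (φ t : E)) φ.source := J.contDiff.comp_contDiffOn hφ
    exact this
  · intro t ht
    have hd : DifferentiableAt ℝ (fun t => (φ t : E)) t :=
      (hφ.contDiffAt (φ.open_source.mem_nhds ht)).differentiableAt (by simp)
    have : fderiv ℝ (fun t => ((φ.transHomeomorph H) t : E')) t
        = J.comp (fderiv ℝ (fun t => (φ t : E)) t) :=
      (J.hasFDerivAt.comp t hd.hasFDerivAt).fderiv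
    rw [this]
    exact hJ.comp (hi t ht)

open Filter Topology in
/-- A nonempty regular level set is an embedded submanifold of the expected dimension. -/
theorem hasFreeRealParameters_levelSet {E G : Type*} [NormedAddCommGroup E] [NormedSpace ℝ E]
    [NormedAddCommGroup G] [NormedSpace ℝ G] [FiniteDimensional ℝ E] [FiniteDimensional ℝ G]
    {F : E → G} (hF : ContDiff ℝ ω F) {d : ℕ}
    (hne : {x | F x = 0}.Nonempty)
    (hsurj : ∀ x, F x = 0 → Function.Surjective (fderiv ℝ F x))
    (hd : Module.finrank ℝ E = Module.finrank ℝ G + d) :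
    HasFreeRealParameters {x | F x = 0} d := by
  refine ⟨hne, fun y => ?_⟩
  obtain ⟨y, hy : F y = 0⟩ := y
  let A := fderiv ℝ F y
  have hA : Function.Surjective A := hsurj y hy
  have hker : Module.finrank ℝ A.ker = d := by
    have h1 := A.toLinearMap.finrank_range_add_finrank_ker
    rw [LinearMap.range_eq_top.2 hA, finrank_top] at h1
    omega
  -- Completing `F` by a projection `p` onto the kernel of its derivative gives `Φ = (F, p)` with
  -- invertible derivative at `y`. The chart is `t ↦ Φ⁻¹ (0, t)`.
  obtain ⟨π, hπ⟩ := LinearMap.exists_leftInverse_of_injective (A.ker.subtype)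
    (Submodule.ker_subtype _)
  let ι : A.ker ≃L[ℝ] EuclideanSpace ℝ (Fin d) :=
    ContinuousLinearEquiv.ofFinrankEq (by rw [hker, finrank_euclideanSpace_fin])
  let p : E →L[ℝ] EuclideanSpace ℝ (Fin d) := LinearMap.toContinuousLinearMap
    (ι.toLinearMap ∘ₗ π)
  have hinj : Function.Injective (A.prod p) := by
    rw [injective_iff_map_eq_zero]
    intro x hx
    have h1 : A x = 0 := congrArg Prod.fst hx
    have h2 : ι (π x) = 0 := congrArg Prod.snd hx
    have h3 : π x = ⟨x, h1⟩ := LinearMap.congr_fun hπ ⟨x, h1⟩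
    have h4 : π x = 0 := by simpa using h2
    rw [h4] at h3
    exact (congrArg Subtype.val h3).symm
  let B : E ≃L[ℝ] G × EuclideanSpace ℝ (Fin d) :=
    (LinearEquiv.ofInjectiveOfFinrankEq (A.prod p).toLinearMap hinj
      (by rw [hd, Module.finrank_prod, finrank_euclideanSpace_fin])).toContinuousLinearEquiv
  let Φ : E → G × EuclideanSpace ℝ (Fin d) := fun x => (F x, p x)
  have hΦ : ContDiff ℝ ω Φ := hF.prodMk p.contDiff
  have hΦ' : HasFDerivAt Φ (B : E →L[ℝ] G × EuclideanSpace ℝ (Fin d)) y :=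
    ((hF.differentiable (by simp)) y).hasFDerivAt.prodMk p.hasFDerivAt
  let e := hΦ.contDiffAt.toOpenPartialHomeomorph Φ hΦ' (by simp)
  have he : ∀ x, e x = Φ x := fun x => rfl
  have hye : y ∈ e.source := hΦ.contDiffAt.mem_toOpenPartialHomeomorph_source hΦ' (by simp)
  -- Regularity `ω` is used because analyticity at a point persists nearby, whereas `ContDiffAt` of
  -- order `∞` need not.
  have hsm : ∀ᶠ z in 𝓝 (Φ y), ContDiffAt ℝ ω e.symm z :=
    (hΦ.contDiffAt.to_localInverse hΦ' (by simp)).eventually (by simp)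
  obtain ⟨W, hW, hWo, hyW⟩ := eventually_nhds_iff.1 hsm
  let j : EuclideanSpace ℝ (Fin d) → G × EuclideanSpace ℝ (Fin d) := fun t => (0, t)
  have hj : ContDiff ℝ ω j := contDiff_const.prodMk contDiff_id
  have hval : ∀ t, j t ∈ e.target → F (e.symm (j t)) = 0 ∧ p (e.symm (j t)) = t := by
    intro t ht
    have h1 : Φ (e.symm (j t)) = j t := e.right_inv ht
    exact ⟨congrArg Prod.fst h1, congrArg Prod.snd h1⟩
  have hjp : ∀ x, F x = 0 → j (p x) = e x := fun x hx => by rw [he]; simp only [j, Φ, hx]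
  classical
  let φ : OpenPartialHomeomorph (EuclideanSpace ℝ (Fin d)) {x | F x = 0} :=
    { toFun := fun t => if h : F (e.symm (j t)) = 0 then ⟨e.symm (j t), h⟩ else ⟨y, hy⟩
      invFun := fun s => p s
      source := j ⁻¹' (e.target ∩ W)
      target := (fun s : {x | F x = 0} => (s : E)) ⁻¹' (e.source ∩ e ⁻¹' W)
      map_source' := by
        rintro t ⟨ht, htW⟩
        rw [Set.mem_preimage, dif_pos (hval t ht).1]
        exact ⟨e.map_target ht, by rw [Set.mem_preimage, e.right_inv ht]; exact htW⟩
      map_target' := by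
        rintro ⟨x, hx⟩ ⟨h1, h2⟩
        rw [Set.mem_preimage, hjp x hx]
        exact ⟨e.map_source h1, h2⟩
      left_inv' := by
        rintro t ⟨ht, htW⟩
        rw [dif_pos (hval t ht).1]
        exact (hval t ht).2
      right_inv' := by
        rintro ⟨x, hx⟩ ⟨h1, h2⟩
        have h3 : e.symm (j (p x)) = x := by rw [hjp x hx, e.left_inv h1]
        apply Subtype.ext
        rw [dif_pos (by rw [h3]; exact hx)]
        exact h3
      open_source := (e.open_target.inter hWo).preimage hj.continuous
      open_target := (e.isOpen_inter_preimage hWo).preimage continuous_subtype_val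
      continuousOn_toFun := by
        rw [Topology.IsInducing.subtypeVal.continuousOn_iff]
        refine ContinuousOn.congr (f := fun t => e.symm (j t)) ?_ ?_
        · exact e.continuousOn_symm.comp hj.continuous.continuousOn fun t ht => ht.1
        · intro t ht
          simp only [Function.comp]
          rw [dif_pos (hval t ht.1).1]
      continuousOn_invFun := (p.continuous.comp continuous_subtype_val).continuousOn }
  have hφ : ∀ t ∈ φ.source, ((φ t : {x | F x = 0}) : E) = e.symm (j t) := by
    intro t ht
    change ((if h : F (e.symm (j t)) = 0 then ⟨e.symm (j t), h⟩ else ⟨y, hy⟩ :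
      {x | F x = 0}) : E) = _
    rw [dif_pos (hval t ht.1).1]
  have hsmooth : ContDiffOn ℝ ∞ (fun t => ((φ t : {x | F x = 0}) : E)) φ.source := by
    refine ContDiffOn.congr (f := fun t => e.symm (j t)) ?_ hφ
    intro t ht
    have h1 : ContDiffAt ℝ ω (fun t => e.symm (j t)) t :=
      ContDiffAt.comp t (hW _ ht.2) hj.contDiffAt
    exact (h1.of_le (by simp)).contDiffWithinAt
  refine ⟨φ, ⟨hye, hyW⟩, hsmooth, fun t ht => ?_⟩
  have hdiff : DifferentiableAt ℝ (fun t => ((φ t : {x | F x = 0}) : E)) t :=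
    (hsmooth.contDiffAt (φ.open_source.mem_nhds ht)).differentiableAt (by simp)
  -- Since `p` is a linear left inverse of the chart, it is also a left inverse of the derivative of
  -- the chart.
  have h1 := p.hasFDerivAt.comp t hdiff.hasFDerivAt
  have h2 : (p ∘ fun t => ((φ t : {x | F x = 0}) : E)) =ᶠ[𝓝 t] id := by
    filter_upwards [φ.open_source.mem_nhds ht] with s hs
    simp only [Function.comp, hφ s hs, id, (hval s hs.1).2]
  have h3 := (h1.congr_of_eventuallyEq h2.symm).unique (hasFDerivAt_id t)
  have h4 : Function.LeftInverse p (fderiv ℝ (fun t => ((φ t : {x | F x = 0}) : E)) t) :=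
    fun v => by simpa using DFunLike.congr_fun h3 v
  exact h4.injective

/-! ### Takagi factorization through antilinear eigenvectors. -/

section Takagi

variable {V : Type*} [NormedAddCommGroup V] [InnerProductSpace ℂ V] [FiniteDimensional ℂ V]

/-- A symmetric antilinear operator has a unit eigenvector with nonnegative eigenvalue in every
nonzero invariant subspace. -/
theorem exists_antilinear_eigenvector (T : V →ₛₗ[starRingEnd ℂ] V)
    (hT : ∀ v w, inner ℂ v (T w) = inner ℂ w (T v)) (W : Submodule ℂ V) (hW : W ≠ ⊥)
    (hTW : ∀ w ∈ W, T w ∈ W) :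
    ∃ v ∈ W, ‖v‖ = 1 ∧ ∃ σ : ℝ, 0 ≤ σ ∧ T v = (σ : ℂ) • v := by
  suffices h : ∃ v ∈ W, v ≠ 0 ∧ ∃ σ : ℝ, 0 ≤ σ ∧ T v = (σ : ℂ) • v by
    obtain ⟨v, hv, hv0, σ, hσ, hTv⟩ := h
    refine ⟨((‖v‖⁻¹ : ℝ) : ℂ) • v, W.smul_mem _ hv, ?_, σ, hσ, ?_⟩
    · rw [norm_smul, Complex.norm_real, norm_inv, norm_norm,
        inv_mul_cancel₀ (norm_ne_zero_iff.2 hv0)]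
    · rw [T.map_smulₛₗ, hTv, Complex.conj_ofReal, smul_comm]
  have : Nontrivial W := Submodule.nontrivial_iff_ne_bot.2 hW
  -- The square of an antilinear map is linear, so it has an eigenvector `v` in `W`; symmetry then
  -- forces the eigenvalue to be `σ ^ 2` with `σ = ‖T v‖ / ‖v‖`.
  let T2 : V →ₗ[ℂ] V := T.comp T
  obtain ⟨μ, hμ⟩ := Module.End.exists_eigenvalue
    (T2.restrict (p := W) (q := W) fun w hw => hTW _ (hTW _ hw))
  obtain ⟨⟨v, hv⟩, hvμ, hv0⟩ := hμ.exists_hasEigenvector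
  replace hv0 : v ≠ 0 := fun h => hv0 (Subtype.ext h)
  have hTT : T (T v) = μ • v := congrArg Subtype.val (Module.End.mem_eigenspace_iff.1 hvμ)
  have h1 : (‖T v‖ : ℂ) ^ 2 = μ * (‖v‖ : ℂ) ^ 2 := by
    have h2 := hT v (T v)
    rw [hTT, inner_smul_right, inner_self_eq_norm_sq_to_K, inner_self_eq_norm_sq_to_K] at h2
    exact h2.symm
  have hvn : (‖v‖ : ℂ) ≠ 0 := by exact_mod_cast norm_ne_zero_iff.2 hv0
  let σ : ℝ := ‖T v‖ / ‖v‖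
  have hσ : 0 ≤ σ := by positivity
  have hμσ : μ = (σ : ℂ) * σ := by
    simp only [σ]
    push_cast
    field_simp
    exact h1.symm
  -- As `T (T v) = σ ^ 2 • v`, the vector `T v + σ • v` is an eigenvector for `σ` unless it
  -- vanishes. In that case `T v = -σ • v`, and multiplying `v` by `I` flips the sign by
  -- antilinearity.
  by_cases hu : T v + (σ : ℂ) • v = 0
  · refine ⟨Complex.I • v, W.smul_mem _ hv, smul_ne_zero Complex.I_ne_zero hv0, σ, hσ, ?_⟩
    rw [T.map_smulₛₗ, eq_neg_of_add_eq_zero_left hu, Complex.conj_I, neg_smul_neg, smul_comm]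
  · refine ⟨_, W.add_mem (hTW v hv) (W.smul_mem _ hv), hu, σ, hσ, ?_⟩
    rw [map_add, hTT, T.map_smulₛₗ, Complex.conj_ofReal, hμσ, smul_add, smul_smul, add_comm]

/-- The orthogonal complement of the eigenvectors already found is invariant, since `⟪b i, T w⟫ =
⟪w, T (b i)⟫ = σ i * ⟪w, b i⟫ = 0`; as long as it is nonzero it contains one more. -/
theorem exists_orthonormal_antilinear_eigenvectors (T : V →ₛₗ[starRingEnd ℂ] V)
    (hT : ∀ v w, inner ℂ v (T w) = inner ℂ w (T v)) (k : ℕ) (hk : k ≤ Module.finrank ℂ V) :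
    ∃ (b : Fin k → V) (σ : Fin k → ℝ), Orthonormal ℂ b ∧
      ∀ i, 0 ≤ σ i ∧ T (b i) = (σ i : ℂ) • b i := by
  induction k with
  | zero => exact ⟨Fin.elim0, Fin.elim0, ⟨fun i => i.elim0, fun i => i.elim0⟩, fun i => i.elim0⟩
  | succ k ih =>
    obtain ⟨b, σ, hb, hbσ⟩ := ih (by omega)
    let W := (Submodule.span ℂ (Set.range b))ᗮ
    have hmem : ∀ w, w ∈ W ↔ ∀ i, inner ℂ (b i) w = 0 := by
      intro w
      rw [Submodule.mem_orthogonal]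
      refine ⟨fun h i => h _ (Submodule.subset_span ⟨i, rfl⟩), fun h u hu => ?_⟩
      induction hu using Submodule.span_induction with
      | mem x hx => obtain ⟨i, rfl⟩ := hx; exact h i
      | zero => simp
      | add x y _ _ hx hy => rw [inner_add_left, hx, hy, add_zero]
      | smul a x _ hx => rw [inner_smul_left, hx, mul_zero]
    have hW : W ≠ ⊥ := by
      intro h
      have h1 := Submodule.orthogonal_eq_bot_iff.1 h
      have h2 := finrank_range_le_card (R := ℂ) b
      rw [Set.finrank, h1, finrank_top, Fintype.card_fin] at h2
      omega
    obtain ⟨v, hv, hv1, τ, hτ, hTv⟩ := exists_antilinear_eigenvector T hT W hW (by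
      intro w hw
      rw [hmem] at hw ⊢
      intro i
      rw [hT, (hbσ i).2, inner_smul_right, inner_eq_zero_symm.1 (hw i), mul_zero])
    rw [hmem] at hv
    refine ⟨Fin.cons v b, Fin.cons τ σ, ⟨?_, ?_⟩, ?_⟩
    · exact fun i => Fin.cases (by simpa using hv1) (fun i => by simpa using hb.1 i) i
    · intro i j hij
      induction i using Fin.cases with
      | zero =>
        induction j using Fin.cases with
        | zero => exact absurd rfl hij
        | succ j => simpa using inner_eq_zero_symm.1 (hv j)
      | succ i =>
        induction j using Fin.cases with
        | zero => simpa using hv i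
        | succ j => simpa using hb.2 fun h => hij (congrArg Fin.succ h)
    · exact fun i => Fin.cases ⟨by simpa using hτ, by simpa using hTv⟩
        (fun i => by simpa using hbσ i) i

end Takagi

/-- Takagi factorization of a complex symmetric matrix. -/
theorem Matrix.IsSymm.exists_takagi {n : ℕ} {A : Matrix (Fin n) (Fin n) ℂ} (hA : A.IsSymm) :
    ∃ U ∈ Matrix.unitaryGroup (Fin n) ℂ, ∃ σ : Fin n → ℝ, (∀ i, 0 ≤ σ i) ∧
      Uᵀ * A * U = Matrix.diagonal fun i => (σ i : ℂ) := by
  -- The antilinear map is `v ↦ conj (A v)`, symmetric because `A` is; an orthonormal basis of its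
  -- eigenvectors forms the columns of `U`.
  let T : EuclideanSpace ℂ (Fin n) →ₛₗ[starRingEnd ℂ] EuclideanSpace ℂ (Fin n) :=
    { toFun := fun v => WithLp.toLp 2 (star (A *ᵥ v.ofLp))
      map_add' := fun v w => by ext i; simp [Matrix.mulVec_add]
      map_smul' := fun c v => by ext i; simp [Matrix.mulVec_smul] }
  have hTi : ∀ v i, T v i = star ((A *ᵥ v.ofLp) i) := fun v i => rfl
  have hinner : ∀ v w, inner ℂ v (T w) = star (v.ofLp ⬝ᵥ A *ᵥ w.ofLp) := by
    intro v w
    simp only [PiLp.inner_apply, hTi, RCLike.inner_apply, dotProduct, star_sum, star_mul',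
      starRingEnd_apply, mul_comm]
  obtain ⟨b, σ, hb, hbσ⟩ := exists_orthonormal_antilinear_eigenvectors T (fun v w => by
    rw [hinner, hinner, Matrix.dotProduct_mulVec, ← Matrix.mulVec_transpose, hA.eq,
      dotProduct_comm]) n (by simp)
  refine ⟨Matrix.of fun i j => b j i, ?_, σ, fun i => (hbσ i).1, ?_⟩
  · rw [Matrix.mem_unitaryGroup_iff']
    ext j k
    have h := (orthonormal_iff_ite.1 hb) j k
    rw [Matrix.one_apply, ← h, PiLp.inner_apply]
    simp [Matrix.mul_apply, Matrix.star_apply, RCLike.inner_apply, mul_comm]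
  · ext j k
    have h1 := hinner (b j) (b k)
    rw [(hbσ k).2, inner_smul_right, orthonormal_iff_ite.1 hb j k] at h1
    have h2 := congrArg star h1
    rw [star_star] at h2
    rw [Matrix.mul_assoc, Matrix.mul_apply, Matrix.diagonal_apply]
    simp only [dotProduct, Matrix.mulVec] at h2
    simp only [Matrix.mul_apply, Matrix.transpose_apply, Matrix.of_apply]
    rw [← h2]
    split_ifs with h
    · subst h; simp
    · simp

theorem Matrix.rank_transpose_mul_mul_of_mem_unitaryGroup {n : ℕ} {A U : Matrix (Fin n) (Fin n) ℂ}
    (hU : U ∈ Matrix.unitaryGroup (Fin n) ℂ) : (Uᵀ * A * U).rank = A.rank := by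
  have h : IsUnit U.det :=
    Matrix.isUnit_det_of_left_inverse (Matrix.mem_unitaryGroup_iff'.1 hU)
  rw [Matrix.rank_mul_eq_left_of_isUnit_det _ _ h,
    Matrix.rank_mul_eq_right_of_isUnit_det _ _ (by rwa [Matrix.det_transpose])]

/-- Takagi factorization with prescribed positions of the nonzero singular values. -/
theorem Matrix.IsSymm.exists_takagi_pos_iff {n : ℕ} {A : Matrix (Fin n) (Fin n) ℂ} (hA : A.IsSymm)
    (p : Fin n → Prop) [DecidablePred p] (hp : Fintype.card {i // p i} = A.rank) :
    ∃ U ∈ Matrix.unitaryGroup (Fin n) ℂ, ∃ σ : Fin n → ℝ, (∀ i, 0 ≤ σ i) ∧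
      (Uᵀ * A * U = Matrix.diagonal fun i => (σ i : ℂ)) ∧ ∀ i, 0 < σ i ↔ p i := by
  classical
  obtain ⟨U, hU, σ, hσ, h⟩ := hA.exists_takagi
  -- The rank counts the nonzero `σ i`, so some permutation of the columns moves them exactly to the
  -- positions in `p`.
  have hr : Fintype.card {i // (σ i : ℂ) ≠ 0} = A.rank := by
    rw [← Matrix.rank_diagonal, ← h, Matrix.rank_transpose_mul_mul_of_mem_unitaryGroup hU]
  let e := Fintype.equivOfCardEq (hp.trans hr.symm)
  let g : Equiv.Perm (Fin n) := e.extendSubtype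
  refine ⟨U.submatrix id g, ?_, σ ∘ g, fun i => hσ _, ?_, fun i => ?_⟩
  · rw [Matrix.mem_unitaryGroup_iff'] at hU ⊢
    have : star (U.submatrix id g) * U.submatrix id g = (star U * U).submatrix g g := by
      ext; simp [Matrix.mul_apply, Matrix.star_apply]
    rw [this, hU, Matrix.submatrix_one_equiv]
  · have : (U.submatrix id g)ᵀ * A * U.submatrix id g = (Uᵀ * A * U).submatrix g g := by
      ext; simp [Matrix.mul_apply]
    rw [this, h]
    exact Matrix.submatrix_diagonal_equiv _ _
  · by_cases hi : p i
    · have := e.extendSubtype_mem i hi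
      refine ⟨fun _ => hi, fun _ => lt_of_le_of_ne (hσ _) ?_⟩
      intro h0
      exact this (Complex.ofReal_eq_zero.2 h0.symm)
    · have := e.extendSubtype_not_mem i hi
      refine ⟨fun h0 => absurd ?_ this, fun h => absurd h hi⟩
      simpa using h0.ne'

namespace MajoranaModel

theorem isSymm_mν {n : ℕ} (𝓜 : MajoranaModel n) : 𝓜.mν.IsSymm := by
  obtain ⟨Y, hY⟩ := 𝓜.exists_yukawa
  rw [hY, Matrix.IsSymm, Matrix.transpose_smul, Matrix.transpose_mul, Matrix.transpose_mul,
    Matrix.transpose_transpose, 𝓜.symm.eq, Matrix.mul_assoc]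

theorem nonempty_takagi {n : ℕ} (𝓜 : MajoranaModel n) (h : MassHierarchy) :
    Nonempty (𝓜.Takagi h) := by
  classical
  obtain ⟨U, hU, μ, hμ, hUμ, hpos⟩ := 𝓜.isSymm_mν.exists_takagi_pos_iff
    (fun i => 𝓜.rm = 2 → i ≠ h.lightest) (by
      rcases 𝓜.rank_mν with h2 | h3
      · simp only [rm, h2, true_imp_iff]
        cases h <;> rfl
      · simp [rm, h3])
  obtain ⟨W, hW, ν, hν, hWν, hpos'⟩ := 𝓜.symm.exists_takagi_pos_iff
    (fun i => (i : ℕ) < 𝓜.rM) (by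
      rw [Fintype.card_congr (Fin.castLEquiv 𝓜.rM_le).symm, Fintype.card_fin, rM])
  refine ⟨⟨U, Wᴴ, μ, ν, hU, ?_, hμ, hν, hUμ, ?_, fun h2 => ?_, hpos'⟩⟩
  · exact Unitary.star_mem hW
  · have : Wᴴ.map star = Wᵀ := by ext; simp
    rw [this, Matrix.conjTranspose_conjTranspose, hWν]
  · by_contra h0
    exact (hpos _).1 (lt_of_le_of_ne (hμ _) (Ne.symm h0)) h2 rfl

end MajoranaModel

/-! ### The algebra of the parametrization. -/

/-- The candidate is `R = B * Q`, and `B = R * D` amounts to `B` vanishing on `ker D`, that is, `B *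
(1 - Q * D) = 0`. These columns are orthogonal to the range of `B` for the bilinear form, which over
`ℂ` has isotropic vectors; the bound on `k` leaves no room for nonzero ones. -/
theorem Matrix.mem_of_transpose_mul_self_eq {k r m : ℕ} {B : Matrix (Fin k) (Fin m) ℂ}
    {D : Matrix (Fin r) (Fin m) ℂ} {Q : Matrix (Fin m) (Fin r) ℂ} (hDQ : D * Q = 1)
    (hB : Bᵀ * B = Dᵀ * D) (h : r = m ∨ k ≤ m ∧ m ≤ r + 1) :
    ∃ R : Matrix (Fin k) (Fin r) ℂ, Rᵀ * R = 1 ∧ B = R * D := by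
  have hQD : Qᵀ * Dᵀ = 1 := by rw [← Matrix.transpose_mul, hDQ, Matrix.transpose_one]
  refine ⟨B * Q, ?_, ?_⟩
  · rw [Matrix.transpose_mul, Matrix.mul_assoc, ← Matrix.mul_assoc Bᵀ, hB, Matrix.mul_assoc Dᵀ,
      hDQ, Matrix.mul_one, hQD]
  have hD : D * (1 - Q * D) = 0 := by
    rw [Matrix.mul_sub, ← Matrix.mul_assoc, hDQ, Matrix.one_mul, Matrix.mul_one, sub_self]
  suffices hN : B * (1 - Q * D) = 0 by
    rwa [Matrix.mul_sub, Matrix.mul_one, sub_eq_zero, ← Matrix.mul_assoc] at hN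
  rcases h with rfl | ⟨hk, hm⟩
  · rw [mul_eq_one_comm.1 hDQ, sub_self, Matrix.mul_zero]
  have hNB : (B * (1 - Q * D))ᵀ * B = 0 := by
    rw [Matrix.transpose_mul, Matrix.mul_assoc, hB, ← Matrix.mul_assoc, ← Matrix.transpose_mul,
      hD, Matrix.transpose_zero, Matrix.zero_mul]
  have hrank := Matrix.rank_add_rank_le_card_of_mul_eq_zero hNB
  rw [Fintype.card_fin, Matrix.rank_transpose] at hrank
  have hker : LinearMap.ker B.mulVecLin ≤ LinearMap.ker D.mulVecLin := by
    intro x hx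
    rw [LinearMap.mem_ker, Matrix.mulVecLin_apply] at hx ⊢
    have h1 : (Qᵀ * (Bᵀ * B)) *ᵥ x = 0 := by
      rw [← Matrix.mulVec_mulVec, ← Matrix.mulVec_mulVec, hx, Matrix.mulVec_zero,
        Matrix.mulVec_zero]
    rwa [hB, ← Matrix.mul_assoc, hQD, Matrix.one_mul] at h1
  have hDr : D.rank = r := le_antisymm (by simpa using D.rank_le_card_height) (by
    have := Matrix.rank_mul_le_left D Q
    rwa [hDQ, Matrix.rank_one, Fintype.card_fin] at this)
  have e1 := B.mulVecLin.finrank_range_add_finrank_ker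
  have e2 := D.mulVecLin.finrank_range_add_finrank_ker
  rw [← Matrix.rank, Module.finrank_fin_fun] at e1 e2
  have e3 := Submodule.finrank_mono hker
  -- From `ker B ≤ ker D` and `m ≤ r + 1`, only two ranks remain. If it is `m`, then `hrank` and `k
  -- ≤ m` give `B * (1 - Q * D)` rank zero; if it is `r`, the two kernels agree.
  rcases (by omega : B.rank = m ∨ B.rank = r) with hr | hr
  · have h1 : LinearMap.range (B * (1 - Q * D)).mulVecLin = ⊥ :=
      Submodule.finrank_eq_zero.1 (by rw [← Matrix.rank]; omega)
    rwa [LinearMap.range_eq_bot, ← Matrix.toLin'_apply', LinearEquiv.map_eq_zero_iff] at h1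
  · have heq := Submodule.eq_of_le_of_finrank_eq hker (by omega)
    ext i j
    have h1 : (1 - Q * D).col j ∈ LinearMap.ker D.mulVecLin := by
      rw [LinearMap.mem_ker, Matrix.mulVecLin_apply]
      ext i
      exact congrFun (congrFun hD i) j
    rw [← heq] at h1
    exact congrFun (LinearMap.mem_ker.1 h1) i

theorem sqrtMass_transpose_mul_self (h : MassHierarchy) {μ : Fin 3 → ℝ} (hμ : ∀ i, 0 ≤ μ i)
    {r : ℕ} (hr : r = 2 ∨ r = 3) (h0 : r = 2 → μ h.lightest = 0) :
    (sqrtMass h μ r)ᵀ * sqrtMass h μ r = Matrix.diagonal fun i => (μ i : ℂ) := by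
  have hs : ∀ i, ((√(μ i) : ℝ) : ℂ) * ((√(μ i) : ℝ) : ℂ) = μ i := fun i => by
    rw [← Complex.ofReal_mul, Real.mul_self_sqrt (hμ i)]
  rcases hr with rfl | rfl
  · have h0 := h0 rfl
    cases h <;> simp only [MassHierarchy.lightest] at h0 <;> ext i j <;> fin_cases i <;>
      fin_cases j <;> simp [sqrtMass, MassHierarchy.P, MassHierarchy.relabel, Matrix.mul_apply,
        Fin.sum_univ_succ, hs, h0, Fin.rev]
  · simp [sqrtMass, Matrix.diagonal_mul_diagonal, hs]

theorem exists_sqrtMass_mul_eq_one (h : MassHierarchy) {μ : Fin 3 → ℝ}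
    {r : ℕ} (hr : r = 2 ∨ r = 3) (hμ : ∀ i, (r = 2 → i ≠ h.lightest) → 0 < μ i) :
    ∃ Q : Matrix (Fin 3) (Fin r) ℂ, sqrtMass h μ r * Q = 1 := by
  have hs : ∀ i, 0 < μ i → ((√(μ i) : ℝ) : ℂ) ≠ 0 := fun i hi => by
    exact_mod_cast (Real.sqrt_pos.2 hi).ne'
  rcases hr with rfl | rfl
  · refine ⟨h.P * !![0, 0; ((√(h.relabel μ 1) : ℝ) : ℂ)⁻¹, 0;
      0, ((√(h.relabel μ 2) : ℝ) : ℂ)⁻¹], ?_⟩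
    have h1 : 0 < μ 1 := hμ 1 (by cases h <;> simp [MassHierarchy.lightest])
    have h2 : ((√(h.relabel μ 2) : ℝ) : ℂ) ≠ 0 := by
      cases h
      · exact hs 2 (hμ 2 (by simp [MassHierarchy.lightest]))
      · exact hs 0 (hμ 0 (by simp [MassHierarchy.lightest]))
    have h1' : ((√(h.relabel μ 1) : ℝ) : ℂ) ≠ 0 := by cases h <;> exact hs 1 h1
    have hP : h.P * h.P = 1 := by
      cases h
      · simp [MassHierarchy.P]
      · ext i j
        fin_cases i <;> fin_cases j <;> simp [MassHierarchy.P, Matrix.mul_apply, Fin.sum_univ_succ]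
    rw [sqrtMass, Matrix.mul_assoc, ← Matrix.mul_assoc h.P, hP, Matrix.one_mul]
    ext i j
    fin_cases i <;> fin_cases j <;> simp [Matrix.mul_apply, Fin.sum_univ_succ, h1', h2]
  · refine ⟨Matrix.diagonal fun i => ((√(μ i) : ℝ) : ℂ)⁻¹, ?_⟩
    rw [sqrtMass, Matrix.diagonal_mul_diagonal, ← Matrix.diagonal_one]
    congr 1
    ext i
    exact mul_inv_cancel₀ (hs i (hμ i (by simp)))

namespace MajoranaModel

variable {n : ℕ} (𝓜 : MajoranaModel n)

theorem f_ne_zero : 𝓜.f ≠ 0 := by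
  intro h
  obtain ⟨Y, hY⟩ := 𝓜.exists_yukawa
  have hr := 𝓜.rank_mν
  rw [hY, h, zero_smul, Matrix.rank_zero] at hr
  omega

theorem rank_smul_transpose_mul_mul {Y : Matrix (Fin n) (Fin 3) ℂ} :
    (𝓜.f • (Yᵀ * 𝓜.M * Y)).rank = (Yᵀ * 𝓜.M * Y).rank :=
  Matrix.rank_smul_of_mem_nonZeroDivisors _ (mem_nonZeroDivisors_of_ne_zero 𝓜.f_ne_zero)

theorem rank_inequalities {Y : Matrix (Fin n) (Fin 3) ℂ} (hY : Y ∈ 𝓜.yukawas) :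
    𝓜.rm ≤ min Y.rank 𝓜.rM ∧ Y.rank ≤ min n 3 ∧ 𝓜.rM ≤ n := by
  refine ⟨?_, le_min (by simpa using Y.rank_le_card_height) (by simpa using Y.rank_le_card_width),
    𝓜.rM_le⟩
  have hY : 𝓜.mν = 𝓜.f • (Yᵀ * 𝓜.M * Y) := hY
  rw [rm, hY, rank_smul_transpose_mul_mul]
  exact le_min (Matrix.rank_mul_le_right _ _)
    ((Matrix.rank_mul_le_left _ _).trans (Matrix.rank_mul_le_right _ _))

theorem rm_eq : 𝓜.rm = 2 ∨ 𝓜.rm = 3 := 𝓜.rank_mν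

theorem rm_le_rM : 𝓜.rm ≤ 𝓜.rM := by
  obtain ⟨Y, hY⟩ := 𝓜.exists_yukawa
  exact (le_min_iff.1 (𝓜.rank_inequalities hY).1).2

/-- The splitting of the row indices used by `stack`. -/
noncomputable def rowEquiv : Fin 𝓜.rM ⊕ Fin (n - 𝓜.rM) ≃ Fin n :=
  finSumFinEquiv.trans (finCongr (Nat.add_sub_cancel' 𝓜.rM_le))

theorem rowEquiv_inl (i : Fin 𝓜.rM) : 𝓜.rowEquiv (Sum.inl i) = Fin.castLE 𝓜.rM_le i := rfl

theorem le_rowEquiv_inr (i : Fin (n - 𝓜.rM)) : 𝓜.rM ≤ (𝓜.rowEquiv (Sum.inr i) : ℕ) := by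
  simp [rowEquiv]

theorem stack_rowEquiv (A : Matrix (Fin 𝓜.rM) (Fin 3) ℂ) (X : Matrix (Fin (n - 𝓜.rM)) (Fin 3) ℂ)
    (i : Fin 𝓜.rM ⊕ Fin (n - 𝓜.rM)) (j : Fin 3) :
    𝓜.stack A X (𝓜.rowEquiv i) j = Matrix.fromRows A X i j := by
  simp [stack, rowEquiv]

theorem exists_eq_stack (S : Matrix (Fin n) (Fin 3) ℂ) : ∃ A X, S = 𝓜.stack A X := by
  refine ⟨Matrix.of fun i j => S (𝓜.rowEquiv (Sum.inl i)) j,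
    Matrix.of fun i j => S (𝓜.rowEquiv (Sum.inr i)) j, ?_⟩
  ext i j
  obtain ⟨i, rfl⟩ := 𝓜.rowEquiv.surjective i
  rw [stack_rowEquiv]
  cases i <;> rfl

theorem stack_injective {A A' : Matrix (Fin 𝓜.rM) (Fin 3) ℂ}
    {X X' : Matrix (Fin (n - 𝓜.rM)) (Fin 3) ℂ} (h : 𝓜.stack A X = 𝓜.stack A' X') :
    A = A' ∧ X = X' := by
  constructor <;> ext i j
  · simpa [stack_rowEquiv] using congrFun (congrFun h (𝓜.rowEquiv (Sum.inl i))) j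
  · simpa [stack_rowEquiv] using congrFun (congrFun h (𝓜.rowEquiv (Sum.inr i))) j

theorem stack_add (A A' : Matrix (Fin 𝓜.rM) (Fin 3) ℂ)
    (X X' : Matrix (Fin (n - 𝓜.rM)) (Fin 3) ℂ) :
    𝓜.stack (A + A') (X + X') = 𝓜.stack A X + 𝓜.stack A' X' := by
  ext i j
  obtain ⟨i, rfl⟩ := 𝓜.rowEquiv.surjective i
  rw [Matrix.add_apply, stack_rowEquiv, stack_rowEquiv, stack_rowEquiv]
  cases i <;> rfl

theorem stack_smul (c : ℝ) (A : Matrix (Fin 𝓜.rM) (Fin 3) ℂ)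
    (X : Matrix (Fin (n - 𝓜.rM)) (Fin 3) ℂ) :
    𝓜.stack (c • A) (c • X) = c • 𝓜.stack A X := by
  ext i j
  obtain ⟨i, rfl⟩ := 𝓜.rowEquiv.surjective i
  rw [Matrix.smul_apply, stack_rowEquiv, stack_rowEquiv]
  cases i <;> rfl

theorem inv_sqrt_f_ne_zero : (𝓜.f ^ (1 / 2 : ℂ))⁻¹ ≠ 0 :=
  inv_ne_zero (by simp [Complex.cpow_eq_zero_iff, 𝓜.f_ne_zero])

theorem f_mul_inv_sqrt_mul_inv_sqrt :
    𝓜.f * ((𝓜.f ^ (1 / 2 : ℂ))⁻¹ * (𝓜.f ^ (1 / 2 : ℂ))⁻¹) = 1 := by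
  rw [← mul_inv, ← Complex.cpow_add _ _ 𝓜.f_ne_zero]
  norm_num
  exact mul_inv_cancel₀ 𝓜.f_ne_zero

namespace Takagi

variable {𝓜} {h : MassHierarchy} (T : 𝓜.Takagi h)

theorem heavyMass_eq_zero {i : Fin n} (hi : 𝓜.rM ≤ i) : T.heavyMass i = 0 :=
  le_antisymm (not_lt.1 fun h0 => absurd ((T.heavyMass_pos i).1 h0) (not_lt.2 hi))
    (T.heavyMass_nonneg i)

theorem heavyMass_castLE_pos (i : Fin 𝓜.rM) : 0 < T.heavyMass (Fin.castLE 𝓜.rM_le i) :=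
  (T.heavyMass_pos _).2 (by simp)

/-- Exactly `rm` light masses are nonzero, so a further zero would leave too few. -/
theorem lightMass_pos (i : Fin 3) (hi : 𝓜.rm = 2 → i ≠ h.lightest) : 0 < T.lightMass i := by
  classical
  have hr : Fintype.card {i // (T.lightMass i : ℂ) ≠ 0} = 𝓜.rm := by
    have hu : IsUnit T.U.det :=
      Matrix.isUnit_det_of_left_inverse (Matrix.mem_unitaryGroup_iff'.1 T.U_unitary)
    rw [← Matrix.rank_diagonal, ← T.light_eq, Matrix.rank_mul_eq_left_of_isUnit_det _ _ hu,
      Matrix.rank_mul_eq_right_of_isUnit_det _ _ (by rwa [Matrix.det_transpose]), rm]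
  refine lt_of_le_of_ne (T.lightMass_nonneg i) fun h0 => ?_
  rw [Fintype.card_subtype] at hr
  rcases 𝓜.rm_eq with h2 | h3
  · have hsub : Finset.univ.filter (fun i => (T.lightMass i : ℂ) ≠ 0) ⊆
        Finset.univ \ {i, h.lightest} := by
      intro j hj
      simp only [Finset.mem_filter, Finset.mem_univ, true_and, Complex.ofReal_ne_zero] at hj
      simp only [Finset.mem_sdiff, Finset.mem_univ, true_and, Finset.mem_insert,
        Finset.mem_singleton, not_or]
      exact ⟨fun e => hj (e ▸ h0.symm), fun e => hj (e ▸ T.lightest_eq h2)⟩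
    have hc := Finset.card_le_card hsub
    rw [hr, Finset.card_sdiff_of_subset (Finset.subset_univ _), Finset.card_pair (hi h2),
      Finset.card_univ, Fintype.card_fin] at hc
    omega
  · have hsub : Finset.univ.filter (fun i => (T.lightMass i : ℂ) ≠ 0) ⊆ Finset.univ \ {i} := by
      intro j hj
      simp only [Finset.mem_filter, Finset.mem_univ, true_and, Complex.ofReal_ne_zero] at hj
      simp only [Finset.mem_sdiff, Finset.mem_univ, true_and, Finset.mem_singleton]
      exact fun e => hj (e ▸ h0.symm)
    have hc := Finset.card_le_card hsub
    rw [hr, Finset.card_sdiff_of_subset (Finset.subset_univ _), Finset.card_singleton,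
      Finset.card_univ, Fintype.card_fin] at hc
    omega

theorem exists_sqrtMass_right_inverse :
    ∃ Q : Matrix (Fin 3) (Fin 𝓜.rm) ℂ, sqrtMass h T.lightMass 𝓜.rm * Q = 1 :=
  exists_sqrtMass_mul_eq_one h 𝓜.rm_eq T.lightMass_pos

theorem sqrtMass_gram : (sqrtMass h T.lightMass 𝓜.rm)ᵀ * sqrtMass h T.lightMass 𝓜.rm =
    Matrix.diagonal fun i => (T.lightMass i : ℂ) :=
  sqrtMass_transpose_mul_self h T.lightMass_nonneg 𝓜.rm_eq T.lightest_eq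

theorem U_mul_conjTranspose : T.U * T.Uᴴ = 1 := Matrix.mem_unitaryGroup_iff.1 T.U_unitary

theorem conjTranspose_mul_U : T.Uᴴ * T.U = 1 := Matrix.mem_unitaryGroup_iff'.1 T.U_unitary

theorem V_mul_conjTranspose : T.V * T.Vᴴ = 1 := Matrix.mem_unitaryGroup_iff.1 T.V_unitary

theorem conjTranspose_mul_V : T.Vᴴ * T.V = 1 := Matrix.mem_unitaryGroup_iff'.1 T.V_unitary

theorem U_conj_congr_eq_iff (A B : Matrix (Fin 3) (Fin 3) ℂ) :
    T.Uᵀ * A * T.U = T.Uᵀ * B * T.U ↔ A = B := by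
  refine ⟨fun e => ?_, fun e => by rw [e]⟩
  have h1 : T.Uᴴᵀ * T.Uᵀ = 1 := by
    rw [← Matrix.transpose_mul, T.U_mul_conjTranspose, Matrix.transpose_one]
  have h2 : ∀ C, T.Uᴴᵀ * (T.Uᵀ * C * T.U) * T.Uᴴ = C := by
    intro C
    rw [Matrix.mul_assoc T.Uᵀ, ← Matrix.mul_assoc T.Uᴴᵀ, h1, Matrix.one_mul, Matrix.mul_assoc,
      T.U_mul_conjTranspose, Matrix.mul_one]
  rw [← h2 A, e, h2]

/-- The matrix `√D_{rM}`. -/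
noncomputable def sqrtHeavy : Matrix (Fin 𝓜.rM) (Fin 𝓜.rM) ℂ :=
  Matrix.diagonal fun i => ((√(T.heavyMass (Fin.castLE 𝓜.rM_le i)) : ℝ) : ℂ)

theorem sqrtHeavy_mul_inv : T.sqrtHeavy * T.sqrtHeavyInv = 1 := by
  rw [sqrtHeavy, sqrtHeavyInv, Matrix.diagonal_mul_diagonal, ← Matrix.diagonal_one]
  congr 1
  ext i
  exact mul_inv_cancel₀ (by exact_mod_cast (Real.sqrt_pos.2 (T.heavyMass_castLE_pos i)).ne')

theorem sqrtHeavyInv_mul : T.sqrtHeavyInv * T.sqrtHeavy = 1 :=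
  mul_eq_one_comm.1 T.sqrtHeavy_mul_inv

/-- The rows of `X` are weighted by vanishing heavy masses, so `X` drops out of the mass equation.
-/
theorem stack_gram (A : Matrix (Fin 𝓜.rM) (Fin 3) ℂ) (X : Matrix (Fin (n - 𝓜.rM)) (Fin 3) ℂ) :
    (𝓜.stack A X)ᵀ * (Matrix.diagonal fun i => (T.heavyMass i : ℂ)) * 𝓜.stack A X =
      (T.sqrtHeavy * A)ᵀ * (T.sqrtHeavy * A) := by
  ext j k
  have hs : ∀ i : Fin 𝓜.rM, ((√(T.heavyMass (Fin.castLE 𝓜.rM_le i)) : ℝ) : ℂ) *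
      ((√(T.heavyMass (Fin.castLE 𝓜.rM_le i)) : ℝ) : ℂ) = T.heavyMass (Fin.castLE 𝓜.rM_le i) :=
    fun i => by rw [← Complex.ofReal_mul, Real.mul_self_sqrt (T.heavyMass_nonneg _)]
  rw [Matrix.mul_apply, Matrix.mul_apply, ← 𝓜.rowEquiv.sum_comp, Fintype.sum_sum_type]
  simp only [Matrix.mul_diagonal, Matrix.transpose_apply, stack_rowEquiv, sqrtHeavy,
    T.heavyMass_eq_zero (𝓜.le_rowEquiv_inr _), Matrix.diagonal_mul, Matrix.fromRows_apply_inl,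
    Complex.ofReal_zero, mul_zero, zero_mul, Finset.sum_const_zero, add_zero]
  simp only [rowEquiv_inl]
  refine Finset.sum_congr rfl fun i _ => ?_
  rw [← hs i]
  ring

/-- Both Takagi decompositions are used here to turn the mass equation into `Bᵀ * B = Dᵀ * D` with
`B = T.sqrtHeavy * A * T.U`. -/
theorem stack_mem_yukawas_iff (A : Matrix (Fin 𝓜.rM) (Fin 3) ℂ)
    (X : Matrix (Fin (n - 𝓜.rM)) (Fin 3) ℂ) :
    (𝓜.f ^ (1 / 2 : ℂ))⁻¹ • (T.Vᴴ * 𝓜.stack A X) ∈ 𝓜.yukawas ↔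
      (T.sqrtHeavy * A * T.U)ᵀ * (T.sqrtHeavy * A * T.U) =
        (sqrtMass h T.lightMass 𝓜.rm)ᵀ * sqrtMass h T.lightMass 𝓜.rm := by
  have hV : T.Vᴴᵀ = T.V.map star := by ext; simp
  have h1 : 𝓜.f • (((𝓜.f ^ (1 / 2 : ℂ))⁻¹ • (T.Vᴴ * 𝓜.stack A X))ᵀ * 𝓜.M *
      ((𝓜.f ^ (1 / 2 : ℂ))⁻¹ • (T.Vᴴ * 𝓜.stack A X))) =
      (T.sqrtHeavy * A)ᵀ * (T.sqrtHeavy * A) := by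
    rw [Matrix.transpose_smul, Matrix.smul_mul, Matrix.smul_mul, Matrix.mul_smul, smul_smul,
      smul_smul, mul_assoc, 𝓜.f_mul_inv_sqrt_mul_inv_sqrt, one_smul, ← T.stack_gram A X, ← T.heavy_eq,
      Matrix.transpose_mul, hV]
    simp only [Matrix.mul_assoc]
  have h2 : T.Uᵀ * ((T.sqrtHeavy * A)ᵀ * (T.sqrtHeavy * A)) * T.U =
      (T.sqrtHeavy * A * T.U)ᵀ * (T.sqrtHeavy * A * T.U) := by
    rw [Matrix.transpose_mul (T.sqrtHeavy * A) T.U]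
    simp only [Matrix.mul_assoc]
  rw [yukawas, Set.mem_ofPred_eq, h1, ← T.U_conj_congr_eq_iff, T.light_eq, h2, T.sqrtMass_gram]
  exact eq_comm

theorem sqrtHeavy_mul_parametrization (R : Matrix (Fin 𝓜.rM) (Fin 𝓜.rm) ℂ) :
    T.sqrtHeavy * (T.sqrtHeavyInv * R * sqrtMass h T.lightMass 𝓜.rm * T.Uᴴ) * T.U =
      R * sqrtMass h T.lightMass 𝓜.rm := by
  simp only [Matrix.mul_assoc, T.conjTranspose_mul_U, Matrix.mul_one]
  rw [← Matrix.mul_assoc, T.sqrtHeavy_mul_inv, Matrix.one_mul]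

theorem casasIbarra_subset : T.casasIbarra ⊆ 𝓜.yukawas := by
  rintro Y ⟨R, X, hR, rfl⟩
  rw [yukawa, stack_mem_yukawas_iff, T.sqrtHeavy_mul_parametrization, Matrix.transpose_mul,
    Matrix.mul_assoc, ← Matrix.mul_assoc Rᵀ, hR, Matrix.one_mul]

theorem casasIbarra_eq (hr : 𝓜.rm = 3 ∨ 𝓜.rM ≤ 3) : T.casasIbarra = 𝓜.yukawas := by
  refine T.casasIbarra_subset.antisymm fun Y hY => ?_
  -- Undoing the factor `1 / √f` and the rotation `V†` lets any solution be split into the two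
  -- blocks.
  obtain ⟨A, X, hS⟩ := 𝓜.exists_eq_stack (𝓜.f ^ (1 / 2 : ℂ) • (T.V * Y))
  have hY' : Y = (𝓜.f ^ (1 / 2 : ℂ))⁻¹ • (T.Vᴴ * 𝓜.stack A X) := by
    rw [← hS, Matrix.mul_smul, smul_smul, inv_mul_cancel₀ (fun h0 => 𝓜.inv_sqrt_f_ne_zero (by rw [h0, inv_zero])),
      one_smul, ← Matrix.mul_assoc, T.conjTranspose_mul_V, Matrix.one_mul]
  rw [hY', stack_mem_yukawas_iff] at hY
  obtain ⟨Q, hQ⟩ := T.exists_sqrtMass_right_inverse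
  obtain ⟨R, hR, hB⟩ := Matrix.mem_of_transpose_mul_self_eq hQ hY (by
    rcases 𝓜.rm_eq with h2 | h3
    · exact Or.inr ⟨by omega, by omega⟩
    · exact Or.inl h3)
  refine ⟨R, X, hR, ?_⟩
  have hA : A = T.sqrtHeavyInv * R * sqrtMass h T.lightMass 𝓜.rm * T.Uᴴ := by
    rw [Matrix.mul_assoc T.sqrtHeavyInv, ← hB]
    simp only [Matrix.mul_assoc, T.U_mul_conjTranspose, Matrix.mul_one]
    rw [← Matrix.mul_assoc, T.sqrtHeavyInv_mul, Matrix.one_mul]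
  rw [hY', hA, yukawa]

/-- All factors but `sqrtMass` are invertible, and `sqrtMass` has a right inverse. Hence no
parameter in `R` or `X` is redundant. -/
theorem yukawa_injective {R R' : Matrix (Fin 𝓜.rM) (Fin 𝓜.rm) ℂ}
    {X X' : Matrix (Fin (n - 𝓜.rM)) (Fin 3) ℂ} (e : T.yukawa R X = T.yukawa R' X') :
    R = R' ∧ X = X' := by
  have e1 := congrArg (T.V * ·) (smul_right_injective _ 𝓜.inv_sqrt_f_ne_zero e)
  simp only [← Matrix.mul_assoc, T.V_mul_conjTranspose, Matrix.one_mul] at e1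
  obtain ⟨e2, e3⟩ := 𝓜.stack_injective e1
  refine ⟨?_, e3⟩
  obtain ⟨Q, hQ⟩ := T.exists_sqrtMass_right_inverse
  have e4 := congrArg (fun A => T.sqrtHeavy * A * T.U) e2
  simp only [T.sqrtHeavy_mul_parametrization] at e4
  have e5 := congrArg (· * Q) e4
  simpa only [Matrix.mul_assoc, hQ, Matrix.mul_one] using e5

/-- The parametrization as a real linear map. -/
noncomputable def yukawaLinearMap :
    Matrix (Fin 𝓜.rM) (Fin 𝓜.rm) ℂ × Matrix (Fin (n - 𝓜.rM)) (Fin 3) ℂ →ₗ[ℝ]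
      Matrix (Fin n) (Fin 3) ℂ where
  toFun p := T.yukawa p.1 p.2
  map_add' p q := by
    simp only [yukawa, Prod.fst_add, Prod.snd_add, Matrix.mul_add, Matrix.add_mul, stack_add,
      smul_add]
  map_smul' c p := by
    simp only [yukawa, Prod.smul_fst, Prod.smul_snd, Matrix.mul_smul, Matrix.smul_mul, stack_smul,
      RingHom.id_apply]
    rw [smul_comm]

end Takagi

end MajoranaModel

/-! ### Regularity and dimension of the level set `Rᵀ * R = 1`. -/

/-- The equations `Rᵀ R = 1`, one for each entry on or above the diagonal. -/
noncomputable def gramDefect {k r m : ℕ}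
    (p : Matrix (Fin k) (Fin r) ℂ × Matrix (Fin m) (Fin 3) ℂ)
    (q : {q : Fin r × Fin r // q.1 ≤ q.2}) : ℂ :=
  (p.1ᵀ * p.1 - 1 : Matrix (Fin r) (Fin r) ℂ) q.1.1 q.1.2

theorem gramDefect_eq_zero_iff {k r m : ℕ}
    (p : Matrix (Fin k) (Fin r) ℂ × Matrix (Fin m) (Fin 3) ℂ) :
    gramDefect p = 0 ↔ p.1ᵀ * p.1 = 1 := by
  refine ⟨fun h => ?_, fun h => by ext q; simp [gramDefect, h]⟩
  have hsymm : (p.1ᵀ * p.1 - 1)ᵀ = p.1ᵀ * p.1 - 1 := by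
    rw [Matrix.transpose_sub, Matrix.transpose_mul, Matrix.transpose_transpose,
      Matrix.transpose_one]
  rw [← sub_eq_zero]
  ext i j
  rcases le_total i j with hij | hij
  · exact congrFun h ⟨(i, j), hij⟩
  · rw [← hsymm]
    exact congrFun h ⟨(j, i), hij⟩

theorem contDiff_gramDefect {k r m : ℕ} :
    ContDiff ℝ ω (gramDefect (k := k) (r := r) (m := m)) := by
  rw [contDiff_pi]
  rintro ⟨⟨i, j⟩, hij⟩
  have hentry : ∀ a b, ContDiff ℝ ω
      fun p : Matrix (Fin k) (Fin r) ℂ × Matrix (Fin m) (Fin 3) ℂ => p.1 a b :=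
    fun a b => (contDiff_apply_apply ℝ ℂ a b).comp contDiff_fst
  simp only [gramDefect, Matrix.sub_apply, Matrix.mul_apply, Matrix.transpose_apply]
  exact (ContDiff.sum fun a _ => (hentry a i).mul (hentry a j)).sub contDiff_const

/-- The derivative of `Rᵀ * R` in direction `H` is `Hᵀ * R + Rᵀ * H`. If `Rᵀ * R = 1` and `S` is the
symmetric matrix with upper triangle `Z`, then `H = R * S / 2` yields `S`. -/
theorem surjective_fderiv_gramDefect {k r m : ℕ}
    (p : Matrix (Fin k) (Fin r) ℂ × Matrix (Fin m) (Fin 3) ℂ) (hp : gramDefect p = 0) :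
    Function.Surjective (fderiv ℝ gramDefect p) := by
  intro Z
  rw [gramDefect_eq_zero_iff] at hp
  let S : Matrix (Fin r) (Fin r) ℂ := Matrix.of fun i j =>
    if h : i ≤ j then Z ⟨(i, j), h⟩ else Z ⟨(j, i), (not_le.1 h).le⟩
  have hS : Sᵀ = S := by
    ext i j
    simp only [S, Matrix.transpose_apply, Matrix.of_apply]
    rcases lt_trichotomy i j with h | rfl | h
    · rw [dif_neg h.not_ge, dif_pos h.le]
    · rfl
    · rw [dif_pos h.le, dif_neg h.not_ge]
  let H : Matrix (Fin k) (Fin r) ℂ := (1 / 2 : ℂ) • (p.1 * S)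
  have hRH : p.1ᵀ * H = (1 / 2 : ℂ) • S := by
    simp only [H, Matrix.mul_smul, ← Matrix.mul_assoc, hp, Matrix.one_mul]
  have hHR : Hᵀ * p.1 = (1 / 2 : ℂ) • S := by
    rw [← Matrix.transpose_transpose p.1, ← Matrix.transpose_mul, hRH, Matrix.transpose_smul, hS]
  let v : Matrix (Fin k) (Fin r) ℂ × Matrix (Fin m) (Fin 3) ℂ := (H, 0)
  refine ⟨v, ?_⟩
  -- Along the line through `p` in direction `v` the equations are quadratic in `t`, with `Z` as
  -- linear coefficient; this gives the derivative without a general formula.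
  have hline : ∀ t : ℝ, gramDefect (p + t • v) =
      t • Z + (t ^ 2) • fun q : {q : Fin r × Fin r // q.1 ≤ q.2} => (Hᵀ * H) q.1.1 q.1.2 := by
    intro t
    have h1 : (p + t • v).1ᵀ * (p + t • v).1 - 1 = t • S + (t ^ 2) • (Hᵀ * H) := by
      simp only [v, Prod.fst_add, Prod.smul_fst, Matrix.transpose_add, Matrix.transpose_smul,
        Matrix.add_mul, Matrix.mul_add, Matrix.smul_mul, Matrix.mul_smul, hp, hRH, hHR]
      module
    ext ⟨⟨i, j⟩, hij⟩
    simp only [gramDefect, h1, Matrix.add_apply, Matrix.smul_apply, Pi.add_apply, Pi.smul_apply, S,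
      Matrix.of_apply, dif_pos (show i ≤ j from hij)]
  have hd1 : HasDerivAt (fun t : ℝ => gramDefect (p + t • v)) (fderiv ℝ gramDefect p v) 0 := by
    have hl : HasDerivAt (fun t : ℝ => p + t • v) v 0 := by
      have := ((hasDerivAt_id (0 : ℝ)).smul_const v).const_add p
      rwa [one_smul] at this
    have hF : HasFDerivAt gramDefect (fderiv ℝ gramDefect p) (p + (0 : ℝ) • v) := by
      rw [zero_smul, add_zero]
      exact (contDiff_gramDefect.differentiable (by simp) p).hasFDerivAt
    exact hF.comp_hasDerivAt (0 : ℝ) hl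
  have hd2 : HasDerivAt (fun t : ℝ => gramDefect (p + t • v)) Z 0 := by
    simp only [hline]
    have h1 := ((hasDerivAt_id (0 : ℝ)).smul_const Z).add
      (((hasDerivAt_id (0 : ℝ)).pow 2).smul_const
        fun q : {q : Fin r × Fin r // q.1 ≤ q.2} => (Hᵀ * H) q.1.1 q.1.2)
    refine h1.congr_deriv ?_
    simp
  exact hd1.unique hd2

theorem exists_transpose_mul_self_eq_one {k r : ℕ} (h : r ≤ k) :
    ∃ R : Matrix (Fin k) (Fin r) ℂ, Rᵀ * R = 1 := by
  refine ⟨(1 : Matrix (Fin k) (Fin k) ℂ).submatrix id (Fin.castLE h), ?_⟩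
  rw [Matrix.transpose_submatrix, Matrix.transpose_one,
    ← Matrix.submatrix_mul _ _ _ _ _ Function.bijective_id, Matrix.one_mul]
  exact Matrix.submatrix_one _ (Fin.castLE_injective h)

theorem hasFreeRealParameters_gramDefect {k r m : ℕ} (hr : r = 2 ∨ r = 3) (h : r ≤ k) :
    HasFreeRealParameters
      {p : Matrix (Fin k) (Fin r) ℂ × Matrix (Fin m) (Fin 3) ℂ | gramDefect p = 0}
      (2 * k * r + 6 * m - r * (r + 1)) := by
  obtain ⟨R, hR⟩ := exists_transpose_mul_self_eq_one h
  refine hasFreeRealParameters_levelSet contDiff_gramDefect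
    ⟨(R, 0), (gramDefect_eq_zero_iff _).2 hR⟩ surjective_fderiv_gramDefect ?_
  rw [Module.finrank_prod, Module.finrank_matrix, Module.finrank_matrix, Module.finrank_pi_fintype]
  simp only [Complex.finrank_real_complex, Fintype.card_fin, Finset.sum_const, smul_eq_mul,
    Finset.card_univ]
  -- There are `r (r + 1) / 2` complex equations, hence `r (r + 1)` real ones.
  have hc : Fintype.card {q : Fin r × Fin r // q.1 ≤ q.2} * 2 = r * (r + 1) := by
    rcases hr with rfl | rfl <;> rfl
  -- This keeps the subtraction in `ℕ` from being truncated.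
  have hle : r * (r + 1) ≤ 2 * k * r := by
    have : r + 1 ≤ 2 * k := by omega
    nlinarith
  rw [hc]
  have : k * r * 2 = 2 * k * r := by ring
  omega

/-! ### The parameter count and its minimum. -/

namespace MajoranaModel

variable {n : ℕ} {𝓜 : MajoranaModel n} {h : MassHierarchy}

theorem Takagi.hasFreeRealParameters (T : 𝓜.Takagi h) :
    HasFreeRealParameters T.casasIbarra
      (2 * 𝓜.rM * 𝓜.rm + 6 * (n - 𝓜.rM) - 𝓜.rm * (𝓜.rm + 1)) := by
  have h1 := (hasFreeRealParameters_gramDefect (m := n - 𝓜.rM) 𝓜.rm_eq 𝓜.rm_le_rM).image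
    (LinearMap.toContinuousLinearMap T.yukawaLinearMap) (by
      intro p q e
      obtain ⟨e1, e2⟩ := T.yukawa_injective e
      exact Prod.ext e1 e2)
  convert h1 using 1
  ext Y
  constructor
  · rintro ⟨R, X, hR, rfl⟩
    exact ⟨(R, X), (gramDefect_eq_zero_iff _).2 hR, rfl⟩
  · rintro ⟨⟨R, X⟩, hR, rfl⟩
    exact ⟨R, X, (gramDefect_eq_zero_iff _).1 hR, rfl⟩

theorem Takagi.hasFreeRealParameters_iff (T : 𝓜.Takagi h) (d : ℕ) :
    HasFreeRealParameters T.casasIbarra d ↔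
      (d : ℤ) = 6 * n - 2 * 𝓜.rM * (3 - 𝓜.rm) - 𝓜.rm * (𝓜.rm + 1) := by
  have hT := T.hasFreeRealParameters
  have hM := 𝓜.rM_le
  have hm := 𝓜.rm_le_rM
  have hr := 𝓜.rm_eq
  set k := 𝓜.rM
  set r := 𝓜.rm
  have hcast : ((2 * k * r + 6 * (n - k) - r * (r + 1) : ℕ) : ℤ) =
      6 * n - 2 * k * (3 - r) - r * (r + 1) := by
    rcases hr with hr | hr <;> rw [hr] at hm ⊢ <;> push_cast <;> omega
  rw [← hcast, Nat.cast_inj]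
  exact ⟨fun hd => hd.unique hT, fun hd => hd ▸ hT⟩

theorem Takagi.two_le_of_hasFreeRealParameters (T : 𝓜.Takagi h) {d : ℕ}
    (hd : HasFreeRealParameters T.casasIbarra d) :
    2 ≤ d ∧ (d = 2 ↔ n = 2 ∧ 𝓜.rM = 2 ∧ 𝓜.rm = 2) := by
  rw [T.hasFreeRealParameters_iff] at hd
  have hM := 𝓜.rM_le
  have hm := 𝓜.rm_le_rM
  -- For `rm = 2`, `d = 6n - 2 rM - 6 ≥ 4n - 6 ≥ 2`, with equality only for `rM = n = 2`. For `rm =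
  -- 3`, `d = 6n - 12 ≥ 6`.
  rcases 𝓜.rm_eq with hr | hr <;> rw [hr] at hd hm ⊢ <;> push_cast at hd <;> omega

theorem Takagi.hasFreeRealParameters_two_iff (T : 𝓜.Takagi h) :
    HasFreeRealParameters T.casasIbarra 2 ↔ n = 2 ∧ 𝓜.rM = 2 ∧ 𝓜.rm = 2 := by
  refine ⟨fun hd => (T.two_le_of_hasFreeRealParameters hd).2.1 rfl, ?_⟩
  rintro ⟨h1, h2, h3⟩
  rw [T.hasFreeRealParameters_iff, h2, h3, h1]
  norm_num

theorem exists_minimal_model : ∃ 𝓜 : MajoranaModel 2, 𝓜.rM = 2 ∧ 𝓜.rm = 2 := by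
  -- With `f = 1` and `M = 1`, this `Y` gives the rank-two mass matrix `diag(1, 1, 0)`.
  let Y : Matrix (Fin 2) (Fin 3) ℂ := !![1, 0, 0; 0, 1, 0]
  have hY : (1 : ℂ) • (Yᵀ * (1 : Matrix (Fin 2) (Fin 2) ℂ) * Y) = Matrix.diagonal ![1, 1, 0] := by
    ext i j
    fin_cases i <;> fin_cases j <;> simp [Y, Matrix.mul_apply]
  have hr : (Matrix.diagonal ![(1 : ℂ), 1, 0]).rank = 2 := by
    classical
    rw [Matrix.rank_diagonal, Fintype.card_subtype]
    have : Finset.univ.filter (fun i => ![(1 : ℂ), 1, 0] i ≠ 0) = {0, 1} := by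
      ext i
      fin_cases i <;> simp
    rw [this]
    rfl
  exact ⟨⟨1, 1, Matrix.diagonal ![1, 1, 0], Matrix.transpose_one, ⟨Y, hY.symm⟩, Or.inl hr⟩,
    by simp [rM], hr⟩

end MajoranaModel

theorem mainTheorem2 :
    -- every model has Takagi decompositions, adapted to either hierarchy
    (∀ (n : ℕ) (𝓜 : MajoranaModel n) (h : MassHierarchy), Nonempty (𝓜.Takagi h)) ∧
    -- the rank inequalities
    (∀ (n : ℕ) (𝓜 : MajoranaModel n), ∀ Y ∈ 𝓜.yukawas,
      𝓜.rm ≤ min Y.rank 𝓜.rM ∧ Y.rank ≤ min n 3 ∧ 𝓜.rM ≤ n) ∧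
    -- the parametrization yields solutions, and all of them if `rm = 3` or `rM ≤ 3`
    (∀ (n : ℕ) (𝓜 : MajoranaModel n) (h : MassHierarchy) (T : 𝓜.Takagi h),
      T.casasIbarra ⊆ 𝓜.yukawas ∧
      (𝓜.rm = 3 ∨ 𝓜.rM ≤ 3 → T.casasIbarra = 𝓜.yukawas)) ∧
    -- the number of real free parameters
    (∀ (n : ℕ) (𝓜 : MajoranaModel n) (h : MassHierarchy) (T : 𝓜.Takagi h) (d : ℕ),
      HasFreeRealParameters T.casasIbarra d ↔
        (d : ℤ) = 6 * n - 2 * 𝓜.rM * (3 - 𝓜.rm) - 𝓜.rm * (𝓜.rm + 1)) ∧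
    -- the minimum is two
    IsLeast {d : ℕ | ∃ (n : ℕ) (𝓜 : MajoranaModel n) (h : MassHierarchy) (T : 𝓜.Takagi h),
      HasFreeRealParameters T.casasIbarra d} 2 ∧
    -- it is reached exactly for `n = rM = rm = 2`
    (∀ (n : ℕ) (𝓜 : MajoranaModel n) (h : MassHierarchy) (T : 𝓜.Takagi h),
      HasFreeRealParameters T.casasIbarra 2 ↔ n = 2 ∧ 𝓜.rM = 2 ∧ 𝓜.rm = 2) ∧
    -- where it counts the real degrees of freedom of all solutions of the mass equation
    (∀ (n : ℕ) (𝓜 : MajoranaModel n), n = 2 ∧ 𝓜.rM = 2 ∧ 𝓜.rm = 2 →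
      HasFreeRealParameters 𝓜.yukawas 2) := by
  refine ⟨fun n 𝓜 h => 𝓜.nonempty_takagi h, fun n 𝓜 Y hY => 𝓜.rank_inequalities hY,
    fun n 𝓜 h T => ⟨T.casasIbarra_subset, T.casasIbarra_eq⟩,
    fun n 𝓜 h T d => T.hasFreeRealParameters_iff d, ⟨?_, ?_⟩,
    fun n 𝓜 h T => T.hasFreeRealParameters_two_iff, ?_⟩
  · obtain ⟨𝓜, hM, hm⟩ := MajoranaModel.exists_minimal_model
    obtain ⟨T⟩ := 𝓜.nonempty_takagi MassHierarchy.NH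
    exact ⟨2, 𝓜, MassHierarchy.NH, T, T.hasFreeRealParameters_two_iff.2 ⟨rfl, hM, hm⟩⟩
  · rintro d ⟨n, 𝓜, h, T, hd⟩
    exact (T.two_le_of_hasFreeRealParameters hd).1
  · intro n 𝓜 hn
    obtain ⟨T⟩ := 𝓜.nonempty_takagi MassHierarchy.NH
    rw [← T.casasIbarra_eq (Or.inr (by omega))]
    exact T.hasFreeRealParameters_two_iff.2 hn
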